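/- Let $\mathcal{M}$ be a smooth manifold (Hausdorff, second countable, without boundary) of dimension $n$, and let $g \colon \mathcal{M} \to \mathcal{M}$ be a $C^1$ map. A set $A \subseteq \mathcal{M}$ has measure zero if $\varphi(A \cap U) \subseteq \mathbb{R}^n$ has Lebesgue measure zero for every smooth chart $(U, \varphi)$ of $\mathcal{M}$. The map $g$ has the Luzin $N^{-1}$ property if, for every $E \subseteq \mathcal{M}$ of measure zero, $g^{-1}(E)$ has measure zero. A point $x^*$ is an unstable fixed point of $g$ if $g(x^*) = x^*$ and $\mathrm{D} g(x^*)$ has a (real or complex) eigenvalue $\lambda$ with $|\lambda| > 1$. Then the following two conditions are equivalent: (a) $g$ has the Luzin $N^{-1}$ property; (b) $\mathrm{D} g(x)$ is invertible for almost every $x \in \mathcal{M}$, i.e., the set of $x$ at which $\mathrm{D} g(x)$ is not invertible has measure zero. Moreover, if (a) holds, or if (b) holds, then $g$ avoids its unstable fixed points: the set of all initial points $x_0 \in \mathcal{M}$ whose orbit $x_{t+1} = g(x_t)$ converges, as $t \to \infty$, to some unstable fixed point of $g$ has measure zero. -/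

import Mathlib

open Filter Topology MeasureTheory
open scoped Manifold ContDiff TensorProduct

/-- A subset `A` of a smooth `n`-manifold `M` has measure zero if, for every smooth chart `φ` of `M`
(that is, every chart of the maximal smooth atlas), the image `φ (A ∩ U)` of the part of `A` in the
chart domain `U` is Lebesgue null in `ℝⁿ`. -/
def MeasureZero {n : ℕ} {M : Type*} [TopologicalSpace M]
    [ChartedSpace (EuclideanSpace ℝ (Fin n)) M] (A : Set M) : Prop :=
  ∀ φ ∈ IsManifold.maximalAtlas (𝓡 n) ∞ M, volume (φ '' (A ∩ φ.source)) = 0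

/-- The Luzin `N⁻¹` property: preimages of sets of measure zero have measure zero. -/
def HasLuzinNInv {n : ℕ} {M : Type*} [TopologicalSpace M]
    [ChartedSpace (EuclideanSpace ℝ (Fin n)) M] (g : M → M) : Prop :=
  ∀ E : Set M, MeasureZero (n := n) E → MeasureZero (n := n) (g ⁻¹' E)

/-- The differential of `g` is invertible at almost every point: the set of points where it is not
invertible has measure zero. -/
def DerivInvertibleAE {n : ℕ} {M : Type*} [TopologicalSpace M]
    [ChartedSpace (EuclideanSpace ℝ (Fin n)) M] (g : M → M) : Prop :=
  MeasureZero (n := n) {x : M | ¬ (mfderiv (𝓡 n) (𝓡 n) g x).IsInvertible}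

/-- The differential of `g` at a fixed point `x`, as an endomorphism of the tangent space at `x`
(the codomain, the tangent space at `g x`, is transported along `g x = x`). -/
noncomputable def derivAtFixedPoint {n : ℕ} {M : Type*} [TopologicalSpace M]
    [ChartedSpace (EuclideanSpace ℝ (Fin n)) M] (g : M → M) (x : M) (h : g x = x) :
    TangentSpace (𝓡 n) x →L[ℝ] TangentSpace (𝓡 n) x :=
  Eq.rec (motive := fun y _ => TangentSpace (𝓡 n) x →L[ℝ] TangentSpace (𝓡 n) y)
    (mfderiv (𝓡 n) (𝓡 n) g x) h

/-- An unstable fixed point of `g`: a point `x` with `g x = x` at which the differential has a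
(possibly non-real) eigenvalue of modulus greater than one. The complex eigenvalues of a real
endomorphism are those of its complexification. -/
def IsUnstableFixedPoint {n : ℕ} {M : Type*} [TopologicalSpace M]
    [ChartedSpace (EuclideanSpace ℝ (Fin n)) M] (g : M → M) (x : M) : Prop :=
  ∃ h : g x = x, ∃ l : ℂ, 1 < ‖l‖ ∧
    Module.End.HasEigenvalue
      (LinearMap.baseChange ℂ (derivAtFixedPoint (n := n) g x h).toLinearMap) l

/-- The stable set of `x`: the initial points whose orbit under `g` converges to `x`. -/
def stableSet {M : Type*} [TopologicalSpace M] (g : M → M) (x : M) : Set M :=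
  {x₀ : M | Tendsto (fun t : ℕ => g^[t] x₀) atTop (𝓝 x)}

/-- `g` avoids the set `S` if the union of the stable sets of the points of `S` has measure zero. -/
def Avoids {n : ℕ} {M : Type*} [TopologicalSpace M]
    [ChartedSpace (EuclideanSpace ℝ (Fin n)) M] (g : M → M) (S : Set M) : Prop :=
  MeasureZero (n := n) (⋃ x ∈ S, stableSet g x)

/-! (a) gives (b) by the equidimensional case of Sard: the critical set has a null image, and the
preimage of that image contains it. (b) gives (a) because, off the critical set, `g` has local `C^1`
inverses, which carry null sets to null sets. Avoidance needs no center-stable manifold. Near an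
unstable fixed point, a difference of two points that lies in the cone `‖Z‖ ≤ ‖U‖`, with `U` the
expanding coordinates of the derivative and `Z` the others, stays there while `‖U‖` grows
exponentially (`exists_expanding_cone`). Two distinct orbits trapped in a bounded neighborhood thus
never differ by a vector inside the cone, so small multiples of one such vector give disjoint
translates of the trapped set, which must be null (`exists_nhds_invariant_null`). Countably many
such neighborhoods suffice, and the Luzin property pulls their trapped sets back along iterates. -/

/-! ### Linear algebra: the expanding cone. -/

/-- Triangularize, then rescale the basis to shrink the off-diagonal part. `D` does not depend on
`η`, so `η` may later be chosen from the gaps between the moduli of `D` and 1. -/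
theorem Module.End.exists_approx_diagonal (k : ℕ) {V : Type*} [AddCommGroup V] [Module ℂ V]
    [FiniteDimensional ℂ V] (f : Module.End ℂ V) (hk : Module.finrank ℂ V = k) :
    ∃ D : Fin k → ℂ, ∀ η : ℝ, 0 < η → ∃ Ψ : V →ₗ[ℂ] (Fin k → ℂ), Function.Injective Ψ ∧
      ∀ x, ‖Ψ (f x) - D * Ψ x‖ ≤ η * ‖Ψ x‖ := by
  induction k generalizing V with
  | zero =>
    have : Subsingleton V := Module.finrank_zero_iff.mp hk
    exact ⟨0, fun η _ => ⟨0, Function.injective_of_subsingleton _, fun x => by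
      rw [Pi.norm_def, Pi.norm_def]; simp⟩⟩
  | succ k ih =>
    have hV : Nontrivial (Module.Dual ℂ V) := by
      apply Module.nontrivial_of_finrank_pos (R := ℂ)
      rw [Subspace.dual_finrank_eq, hk]; omega
    obtain ⟨l, hl⟩ := Module.End.exists_eigenvalue (K := ℂ) (Module.Dual.transpose (R := ℂ) f)
    obtain ⟨φ, hφ⟩ := hl.exists_hasEigenvector
    have hφf : ∀ x, φ (f x) = l * φ x := fun x => by
      have := LinearMap.congr_fun hφ.apply_eq_smul x
      exact this
    obtain ⟨e₀, he₀⟩ : ∃ e, φ e ≠ 0 := by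
      by_contra! h
      exact hφ.2 (LinearMap.ext h)
    obtain ⟨e, he⟩ : ∃ e, φ e = 1 := ⟨(φ e₀)⁻¹ • e₀, by simp [he₀]⟩
    let W := LinearMap.ker φ
    have hW : Module.finrank ℂ W = k := by
      have : Module.finrank ℂ W + 1 = _ := Module.Dual.finrank_ker_add_one_of_ne_zero hφ.2
      omega
    have hfW : ∀ x ∈ W, f x ∈ W := fun x hx => by
      rw [LinearMap.mem_ker] at hx ⊢
      rw [hφf, hx, mul_zero]
    obtain ⟨D, hD⟩ := ih (f.restrict hfW) hW
    refine ⟨Fin.cons l D, fun η hη => ?_⟩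
    obtain ⟨Ψ, hΨ, hΨD⟩ := hD (η / 2) (by positivity)
    let π : V →ₗ[ℂ] W := LinearMap.codRestrict W (LinearMap.id - φ.smulRight e) fun x => by
      simp [W, he]
    have hπ : ∀ x, (π x : V) = x - φ x • e := fun x => rfl
    let c : Fin k → ℂ := Ψ (π (f e))
    -- Stretching the `φ` coordinate by `K` makes its coupling `c` into `W` cost at most `η / 2`;
    -- the other half is spent on `W`.
    let K : ℝ := 2 * ‖c‖ / η + 1
    have hK : 0 < K := by positivity
    let Φ : V →ₗ[ℂ] (Fin (k + 1) → ℂ) :=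
      LinearMap.pi (Fin.cons ((K : ℂ) • φ) fun i => LinearMap.proj i ∘ₗ Ψ ∘ₗ π)
    have hΦ0 : ∀ x, Φ x 0 = K * φ x := fun x => by simp [Φ]
    have hΦs : ∀ x i, Φ x (Fin.succ i) = Ψ (π x) i := fun x i => by simp [Φ]
    have hdec : ∀ x, π (f x) = f.restrict hfW (π x) + φ x • π (f e) := fun x => by
      ext
      simp only [hπ, Submodule.coe_add, Submodule.coe_smul, LinearMap.coe_restrict_apply, map_sub,
        map_smul, hφf, he]
      module
    refine ⟨Φ, ?_, fun x => ?_⟩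
    · rw [injective_iff_map_eq_zero]
      intro x hx
      have h0 : φ x = 0 := by
        have := congr_fun hx 0
        rw [hΦ0] at this
        simpa [hK.ne'] using this
      have h1 : π x = 0 := by
        apply (injective_iff_map_eq_zero Ψ).1 hΨ
        ext i
        rw [← hΦs, hx]; simp
      have := hπ x
      simpa [h1, h0, eq_comm] using this
    · have h0 : K * ‖φ x‖ ≤ ‖Φ x‖ := by
        have := norm_le_pi_norm (Φ x) 0
        rwa [hΦ0, norm_mul, Complex.norm_real, Real.norm_of_nonneg hK.le] at this
      have h1 : ‖Ψ (π x)‖ ≤ ‖Φ x‖ := by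
        refine (pi_norm_le_iff_of_nonneg (norm_nonneg _)).2 fun i => ?_
        rw [← hΦs]
        exact norm_le_pi_norm _ _
      have h2 : ‖φ x‖ * ‖c‖ ≤ η / 2 * ‖Φ x‖ := by
        have : ‖c‖ ≤ η / 2 * K := by
          have : η / 2 * K = ‖c‖ + η / 2 := by simp only [K]; field_simp
          linarith
        calc ‖φ x‖ * ‖c‖ ≤ ‖φ x‖ * (η / 2 * K) := by gcongr
          _ = η / 2 * (K * ‖φ x‖) := by ring
          _ ≤ _ := by gcongr
      refine (pi_norm_le_iff_of_nonneg (by positivity)).2 fun i => ?_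
      refine Fin.cases ?_ (fun i => ?_) i
      · simp only [Pi.sub_apply, Pi.mul_apply, hΦ0, hφf, Fin.cons_zero]
        rw [show (K : ℂ) * (l * φ x) - l * (K * φ x) = 0 by ring, norm_zero]
        positivity
      · simp only [Pi.sub_apply, Pi.mul_apply, hΦs, Fin.cons_succ]
        rw [hdec, map_add, map_smul, Pi.add_apply, Pi.smul_apply, smul_eq_mul]
        calc _ = ‖(Ψ (f.restrict hfW (π x)) - D * Ψ (π x)) i + φ x * c i‖ := by
              congr 1; simp only [Pi.sub_apply, Pi.mul_apply, c]; ring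
          _ ≤ ‖Ψ (f.restrict hfW (π x)) - D * Ψ (π x)‖ + ‖φ x‖ * ‖c‖ := by
              refine (norm_add_le _ _).trans ?_
              rw [norm_mul]
              gcongr <;> exact norm_le_pi_norm _ _
          _ ≤ η / 2 * ‖Φ x‖ + η / 2 * ‖Φ x‖ := by
              refine add_le_add ((hΨD _).trans ?_) h2
              gcongr
          _ = _ := by ring

theorem exists_expanding_cone {E : Type*} [NormedAddCommGroup E] [NormedSpace ℝ E]
    [FiniteDimensional ℝ E] (A : E →L[ℝ] E) {l : ℂ} (hl : 1 < ‖l‖)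
    (hA : Module.End.HasEigenvalue (LinearMap.baseChange ℂ A.toLinearMap) l) :
    ∃ (k : ℕ) (U Z : E →L[ℝ] (Fin k → ℂ)) (η c : ℝ), 0 < η ∧ 0 < c ∧
      (∀ x, ‖x‖ ≤ c * max ‖U x‖ ‖Z x‖) ∧
      (∀ x, (1 + 4 * η) * ‖U x‖ - η * max ‖U x‖ ‖Z x‖ ≤ ‖U (A x)‖) ∧
      (∀ x, ‖Z (A x)‖ ≤ ‖Z x‖ + η * max ‖U x‖ ‖Z x‖) ∧ ∃ v, ‖Z v‖ < ‖U v‖ := by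
  set f := LinearMap.baseChange ℂ A.toLinearMap with hf
  obtain ⟨k, hk⟩ : ∃ k, Module.finrank ℂ (ℂ ⊗[ℝ] E) = k := ⟨_, rfl⟩
  obtain ⟨D, hD⟩ := Module.End.exists_approx_diagonal k f hk
  obtain ⟨η, ⟨hη, hηl⟩, hηD⟩ : ∃ η : ℝ, (0 < η ∧ 1 + η < ‖l‖) ∧
      ∀ i, 1 < ‖D i‖ → 1 + 4 * η ≤ ‖D i‖ := by
    have h0 : ∀ᶠ η : ℝ in 𝓝[>] 0, ∀ i, 1 < ‖D i‖ → 1 + 4 * η ≤ ‖D i‖ := by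
      rw [eventually_all]
      intro i
      rw [eventually_imp_distrib_left]
      intro hi
      filter_upwards [Ioo_mem_nhdsGT (show 0 < (‖D i‖ - 1) / 4 by linarith)] with η hη
      linarith [hη.2]
    have h1 : ∀ᶠ η : ℝ in 𝓝[>] 0, 0 < η ∧ 1 + η < ‖l‖ := by
      filter_upwards [Ioo_mem_nhdsGT (show 0 < ‖l‖ - 1 by linarith)] with η hη
      exact ⟨hη.1, by linarith [hη.2]⟩
    exact (h1.and h0).exists
  obtain ⟨Ψ, hΨ, hΨD⟩ := hD η hη
  let ι : E →ₗ[ℝ] ℂ ⊗[ℝ] E := TensorProduct.mk ℝ ℂ E 1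
  have hι : Function.Injective ι :=
    Module.Flat.rTensor_preserves_injective_linearMap (M := E) (Algebra.linearMap ℝ ℂ)
      (algebraMap ℝ ℂ).injective |>.comp (TensorProduct.lid ℝ E).symm.injective |> fun h => by
        convert h using 1
        ext x; simp [ι]
  let Λ : E →ₗ[ℝ] (Fin k → ℂ) := Ψ.restrictScalars ℝ ∘ₗ ι
  have hΛ : Function.Injective Λ := hΨ.comp hι
  have hΛA : ∀ x, ‖Λ (A x) - D * Λ x‖ ≤ η * ‖Λ x‖ := fun x => hΨD (ι x)
  let up : (Fin k → ℂ) →ₗ[ℝ] (Fin k → ℂ) :=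
    LinearMap.pi fun i => if 1 < ‖D i‖ then LinearMap.proj i else 0
  let lo : (Fin k → ℂ) →ₗ[ℝ] (Fin k → ℂ) :=
    LinearMap.pi fun i => if 1 < ‖D i‖ then 0 else LinearMap.proj i
  have hup : ∀ y i, up y i = if 1 < ‖D i‖ then y i else 0 := fun y i => by
    simp only [up, LinearMap.pi_apply]; split_ifs <;> simp
  have hlo : ∀ y i, lo y i = if 1 < ‖D i‖ then 0 else y i := fun y i => by
    simp only [lo, LinearMap.pi_apply]; split_ifs <;> simp
  have hup_le : ∀ y, ‖up y‖ ≤ ‖y‖ := fun y =>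
    (pi_norm_le_iff_of_nonneg (norm_nonneg _)).2 fun i => by
      rw [hup]; split_ifs
      · exact norm_le_pi_norm _ _
      · simp
  have hlo_le : ∀ y, ‖lo y‖ ≤ ‖y‖ := fun y =>
    (pi_norm_le_iff_of_nonneg (norm_nonneg _)).2 fun i => by
      rw [hlo]; split_ifs
      · simp
      · exact norm_le_pi_norm _ _
  have hmax : ∀ y, ‖y‖ = max ‖up y‖ ‖lo y‖ := fun y => by
    refine le_antisymm ?_ (max_le (hup_le y) (hlo_le y))
    refine (pi_norm_le_iff_of_nonneg (le_max_of_le_left (norm_nonneg _))).2 fun i => ?_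
    by_cases hi : 1 < ‖D i‖
    · refine le_max_of_le_left ?_
      have := norm_le_pi_norm (up y) i
      rwa [hup, if_pos hi] at this
    · refine le_max_of_le_right ?_
      have := norm_le_pi_norm (lo y) i
      rwa [hlo, if_neg hi] at this
  have hupD : ∀ y, (1 + 4 * η) * ‖up y‖ ≤ ‖up (D * y)‖ := fun y => by
    rw [← le_div_iff₀' (by positivity)]
    refine (pi_norm_le_iff_of_nonneg (by positivity)).2 fun i => ?_
    rw [le_div_iff₀' (by positivity)]
    refine le_trans ?_ (norm_le_pi_norm _ i)
    rw [hup, hup]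
    split_ifs with hi
    · rw [Pi.mul_apply, norm_mul]
      gcongr
      exact hηD i hi
    · simp
  have hloD : ∀ y, ‖lo (D * y)‖ ≤ ‖lo y‖ := fun y => by
    refine (pi_norm_le_iff_of_nonneg (norm_nonneg _)).2 fun i => ?_
    refine le_trans ?_ (norm_le_pi_norm _ i)
    rw [hlo, hlo]
    split_ifs with hi
    · simp
    · rw [Pi.mul_apply, norm_mul]
      exact mul_le_of_le_one_left (norm_nonneg _) (not_lt.1 hi)
  have hU : ∀ x, (1 + 4 * η) * ‖up (Λ x)‖ - η * ‖Λ x‖ ≤ ‖up (Λ (A x))‖ := fun x => by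
    have h1 := (hup_le _).trans (hΛA x)
    rw [map_sub] at h1
    have h2 := norm_sub_norm_le (up (D * Λ x)) (up (Λ (A x)))
    rw [norm_sub_rev] at h2
    linarith [hupD (Λ x)]
  have hZ : ∀ x, ‖lo (Λ (A x))‖ ≤ ‖lo (Λ x)‖ + η * ‖Λ x‖ := fun x => by
    have h1 := (hlo_le _).trans (hΛA x)
    rw [map_sub] at h1
    have h2 := norm_sub_norm_le (lo (Λ (A x))) (lo (D * Λ x))
    linarith [hloD (Λ x)]
  obtain ⟨c, hc, hcΛ⟩ := (LinearMap.injective_iff_antilipschitz Λ).1 hΛ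
  refine ⟨k, LinearMap.toContinuousLinearMap (up ∘ₗ Λ), LinearMap.toContinuousLinearMap (lo ∘ₗ Λ),
    η, c, hη, hc, ?_, ?_, ?_, ?_⟩
  · intro x
    simp only [LinearMap.coe_toContinuousLinearMap', LinearMap.comp_apply, ← hmax]
    simpa using hcΛ.le_mul_dist x 0
  · simpa only [LinearMap.coe_toContinuousLinearMap', LinearMap.comp_apply, ← hmax] using hU
  · simpa only [LinearMap.coe_toContinuousLinearMap', LinearMap.comp_apply, ← hmax] using hZ
  -- Nothing records that `l` is an entry of `D`. Instead, an empty open cone bounds the growth of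
  -- `f` by `(1 + η) ^ t`, first on real vectors, then on sums of pure tensors, which contradicts `1
  -- + η < ‖l‖`.
  · by_contra! hv
    simp only [LinearMap.coe_toContinuousLinearMap', LinearMap.comp_apply] at hv
    have hlo_eq : ∀ x, ‖Λ x‖ = ‖lo (Λ x)‖ := fun x => by rw [hmax, max_eq_right (hv x)]
    have hgrow : ∀ x, ‖Λ (A x)‖ ≤ (1 + η) * ‖Λ x‖ := fun x => by
      have := hZ x
      rw [← hlo_eq, ← hlo_eq] at this
      linarith
    have hpow : ∀ w, ∃ C : ℝ, ∀ t : ℕ, ‖Ψ ((f ^ t) w)‖ ≤ (1 + η) ^ t * C := by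
      intro w
      induction w using TensorProduct.induction_on with
      | zero => exact ⟨0, fun t => by simp⟩
      | add a b ha hb =>
        obtain ⟨Ca, ha⟩ := ha
        obtain ⟨Cb, hb⟩ := hb
        refine ⟨Ca + Cb, fun t => ?_⟩
        rw [map_add, map_add, mul_add]
        exact (norm_add_le _ _).trans (add_le_add (ha t) (hb t))
      | tmul z x =>
        have hft : ∀ t : ℕ, (f ^ t) (z ⊗ₜ x) = z • ι ((A.toLinearMap ^ t) x) := fun t => by
          induction t with
          | zero => simp [ι, TensorProduct.smul_tmul']
          | succ t iht =>
            rw [pow_succ', Module.End.mul_apply, iht, pow_succ', Module.End.mul_apply, map_smul]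
            simp [ι, hf]
        have hΛt : ∀ t : ℕ, ‖Λ ((A.toLinearMap ^ t) x)‖ ≤ (1 + η) ^ t * ‖Λ x‖ := fun t => by
          induction t with
          | zero => simp
          | succ t iht =>
            rw [pow_succ', Module.End.mul_apply, pow_succ', mul_assoc]
            refine (hgrow _).trans ?_
            gcongr
        refine ⟨‖z‖ * ‖Λ x‖, fun t => ?_⟩
        rw [hft, map_smul, norm_smul, mul_left_comm]
        exact mul_le_mul_of_nonneg_left (hΛt t) (norm_nonneg _)
    obtain ⟨w, hw⟩ := hA.exists_hasEigenvector
    obtain ⟨C, hC⟩ := hpow w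
    have hw0 : 0 < ‖Ψ w‖ := by
      rw [norm_pos_iff]
      exact fun h => hw.2 (hΨ (h.trans (map_zero _).symm))
    have hwt : ∀ t : ℕ, (‖l‖ / (1 + η)) ^ t ≤ C / ‖Ψ w‖ := fun t => by
      have := hC t
      rw [hw.pow_apply, map_smul, norm_smul, norm_pow] at this
      rw [div_pow, div_le_div_iff₀ (by positivity) hw0]
      linarith
    obtain ⟨t, ht⟩ := ((tendsto_pow_atTop_atTop_of_one_lt
      ((one_lt_div (by positivity)).2 hηl)).eventually_gt_atTop (C / ‖Ψ w‖)).exists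
    exact absurd (hwt t) (not_le.2 ht)

/-! ### Sets trapped near an unstable fixed point. -/

theorem exists_nhds_invariant_null {E : Type*} [NormedAddCommGroup E] [NormedSpace ℝ E]
    [FiniteDimensional ℝ E] [MeasurableSpace E] [BorelSpace E] (μ : Measure E)
    [μ.IsAddHaarMeasure] {G : E → E} {A : E →L[ℝ] E} {p : E} (hG : HasStrictFDerivAt G A p)
    {l : ℂ} (hl : 1 < ‖l‖)
    (hA : Module.End.HasEigenvalue (LinearMap.baseChange ℂ A.toLinearMap) l) :
    ∃ s ∈ 𝓝 p, ∀ W ⊆ s, Set.MapsTo G W W → μ W = 0 := by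
  obtain ⟨k, U, Z, η, c, hη, hc, hbound, hU, hZ, v, hv⟩ := exists_expanding_cone A hl hA
  -- In the cone the linearization error then costs at most `η * ‖U (x - y)‖`, so the factor `1 + 4
  -- * η` drops to `1 + 2 * η`, which still dominates the growth of `Z`.
  obtain ⟨ε, hε, hεη⟩ : ∃ ε : ℝ, 0 < ε ∧ (‖U‖ + ‖Z‖) * ε * c ≤ η := by
    refine ⟨η / ((‖U‖ + ‖Z‖ + 1) * c), by positivity, ?_⟩
    rw [mul_div_assoc', div_mul_eq_mul_div, div_le_iff₀ (by positivity)]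
    nlinarith [mul_pos hη hc]
  obtain ⟨s, hs, hsG⟩ := hG.approximates_deriv_on_nhds (c := ⟨ε, hε.le⟩) (Or.inr hε)
  have hstep : ∀ x ∈ s, ∀ y ∈ s, ‖Z (x - y)‖ ≤ ‖U (x - y)‖ →
      ‖Z (G x - G y)‖ ≤ ‖U (G x - G y)‖ ∧ (1 + 2 * η) * ‖U (x - y)‖ ≤ ‖U (G x - G y)‖ := by
    intro x hx y hy hxy
    have hd : ‖G x - G y - A (x - y)‖ ≤ ε * (c * ‖U (x - y)‖) := by
      refine (hsG x hx y hy).trans (mul_le_mul_of_nonneg_left ?_ hε.le)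
      simpa only [max_eq_left hxy] using hbound (x - y)
    have hUZ : (‖U‖ + ‖Z‖) * ‖G x - G y - A (x - y)‖ ≤ η * ‖U (x - y)‖ :=
      calc _ ≤ (‖U‖ + ‖Z‖) * (ε * (c * ‖U (x - y)‖)) := by gcongr
        _ = (‖U‖ + ‖Z‖) * ε * c * ‖U (x - y)‖ := by ring
        _ ≤ _ := by gcongr
    have h1 := U.le_opNorm (G x - G y - A (x - y))
    have h2 := Z.le_opNorm (G x - G y - A (x - y))
    have h3 := hU (x - y)
    have h4 := hZ (x - y)
    rw [max_eq_left hxy] at h3 h4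
    have h5 := norm_sub_norm_le (U (A (x - y))) (U (G x - G y))
    rw [norm_sub_rev, ← map_sub] at h5
    have h6 := norm_sub_norm_le (Z (G x - G y)) (Z (A (x - y)))
    rw [← map_sub] at h6
    have h7 := mul_nonneg (norm_nonneg U) (norm_nonneg (G x - G y - A (x - y)))
    have h8 := mul_nonneg (norm_nonneg Z) (norm_nonneg (G x - G y - A (x - y)))
    constructor <;> linarith
  refine ⟨s ∩ Metric.closedBall p 1, inter_mem hs (Metric.closedBall_mem_nhds p one_pos),
    fun W hWs hW => ?_⟩
  have hcone : ∀ x ∈ W, ∀ y ∈ W, ‖U (x - y)‖ ≤ ‖Z (x - y)‖ := by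
    intro x hx y hy
    by_contra! hxy
    have hiter : ∀ t : ℕ, ‖Z (G^[t] x - G^[t] y)‖ ≤ ‖U (G^[t] x - G^[t] y)‖ ∧
        (1 + 2 * η) ^ t * ‖U (x - y)‖ ≤ ‖U (G^[t] x - G^[t] y)‖ := fun t => by
      induction t with
      | zero => simpa using hxy.le
      | succ t ih =>
        rw [Function.iterate_succ_apply', Function.iterate_succ_apply']
        have := hstep _ (hWs (hW.iterate t hx)).1 _ (hWs (hW.iterate t hy)).1 ih.1
        refine ⟨this.1, le_trans ?_ this.2⟩
        rw [pow_succ', mul_assoc]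
        exact mul_le_mul_of_nonneg_left ih.2 (by positivity)
    have hpos : 0 < ‖U (x - y)‖ := (norm_nonneg _).trans_lt hxy
    obtain ⟨t, ht⟩ := ((tendsto_pow_atTop_atTop_of_one_lt
      (show 1 < 1 + 2 * η by linarith)).eventually_gt_atTop (‖U‖ * 2 / ‖U (x - y)‖)).exists
    rw [div_lt_iff₀ hpos] at ht
    have hdist : ‖G^[t] x - G^[t] y‖ ≤ 2 := by
      rw [← dist_eq_norm]
      have := dist_triangle_right (G^[t] x) (G^[t] y) p
      have hx' := Metric.mem_closedBall.1 (hWs (hW.iterate t hx)).2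
      have hy' := Metric.mem_closedBall.1 (hWs (hW.iterate t hy)).2
      linarith
    have := (U.le_opNorm (G^[t] x - G^[t] y)).trans
      (mul_le_mul_of_nonneg_left hdist (norm_nonneg U))
    linarith [(hiter t).2]
  -- `W` need not be measurable; its closure is, and the cone condition is closed.
  have hclosure : ∀ x ∈ closure W, ∀ y ∈ closure W, ‖U (x - y)‖ ≤ ‖Z (x - y)‖ := by
    have hcl : IsClosed {q : E × E | ‖U (q.1 - q.2)‖ ≤ ‖Z (q.1 - q.2)‖} :=
      isClosed_le (by fun_prop) (by fun_prop)
    have hsub : closure (W ×ˢ W) ⊆ {q : E × E | ‖U (q.1 - q.2)‖ ≤ ‖Z (q.1 - q.2)‖} :=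
      closure_minimal (fun q hq => hcone _ hq.1 _ hq.2) hcl
    intro x hx y hy
    have hxy : (x, y) ∈ closure (W ×ˢ W) := by
      rw [closure_prod_eq]
      exact ⟨hx, hy⟩
    exact hsub hxy
  -- Infinitely many disjoint translates by a bounded sequence force measure zero.
  refine measure_mono_null subset_closure (Measure.addHaar_eq_zero_of_disjoint_translates μ
    (fun n : ℕ => (1 / ((n : ℝ) + 1)) • v) ?_ ?_ isClosed_closure.measurableSet)
  · exact Metric.isBounded_range_of_tendsto _
      ((tendsto_one_div_add_atTop_nhds_zero_nat (𝕜 := ℝ)).smul_const v)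
  · intro i j hij
    simp only [Function.onFun, Set.disjoint_left, Set.singleton_add, Set.mem_image]
    rintro _ ⟨x, hx, rfl⟩ ⟨y, hy, hxy⟩
    have hxy' : x - y = (1 / ((j : ℝ) + 1) - 1 / ((i : ℝ) + 1)) • v := by
      rw [sub_smul, sub_eq_sub_iff_add_eq_add, add_comm, ← hxy, add_comm]
    have hne : 1 / ((j : ℝ) + 1) - 1 / ((i : ℝ) + 1) ≠ 0 := by
      rw [sub_ne_zero]
      intro h
      rw [one_div, one_div, inv_inj, add_left_inj, Nat.cast_inj] at h
      exact hij h.symm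
    have := hclosure x hx y hy
    rw [hxy', map_smul, map_smul, norm_smul, norm_smul] at this
    exact absurd (le_of_mul_le_mul_left this (norm_pos_iff.2 hne)) (not_le.2 hv)

/-! ### Null sets on a manifold. -/

namespace MeasureZero

theorem mono {n : ℕ} {M : Type*} [TopologicalSpace M]
    [ChartedSpace (EuclideanSpace ℝ (Fin n)) M] {A B : Set M} (hB : MeasureZero (n := n) B)
    (h : A ⊆ B) : MeasureZero (n := n) A := fun φ hφ =>
  measure_mono_null (Set.image_mono (Set.inter_subset_inter_left _ h)) (hB φ hφ)

theorem biUnion {n : ℕ} {M : Type*} [TopologicalSpace M]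
    [ChartedSpace (EuclideanSpace ℝ (Fin n)) M] {ι : Type*} {t : Set ι} (ht : t.Countable)
    {A : ι → Set M} (hA : ∀ i ∈ t, MeasureZero (n := n) (A i)) :
    MeasureZero (n := n) (⋃ i ∈ t, A i) := fun φ hφ => by
  rw [Set.iUnion₂_inter, Set.image_iUnion₂]
  exact (measure_biUnion_null_iff ht).2 fun i hi => hA i hi φ hφ

theorem iUnion {n : ℕ} {M : Type*} [TopologicalSpace M]
    [ChartedSpace (EuclideanSpace ℝ (Fin n)) M] {ι : Type*} [Countable ι]
    {A : ι → Set M} (hA : ∀ i, MeasureZero (n := n) (A i)) :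
    MeasureZero (n := n) (⋃ i, A i) := by
  simpa using biUnion (n := n) (Set.countable_univ (α := ι)) fun i _ => hA i

theorem union {n : ℕ} {M : Type*} [TopologicalSpace M]
    [ChartedSpace (EuclideanSpace ℝ (Fin n)) M] {A B : Set M} (hA : MeasureZero (n := n) A)
    (hB : MeasureZero (n := n) B) : MeasureZero (n := n) (A ∪ B) := by
  rw [Set.union_eq_iUnion]
  exact iUnion fun b => by cases b <;> assumption

theorem of_locally {n : ℕ} {M : Type*} [TopologicalSpace M] [SecondCountableTopology M]
    [ChartedSpace (EuclideanSpace ℝ (Fin n)) M] {A : Set M}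
    (hA : ∀ x ∈ A, ∃ s ∈ 𝓝 x, MeasureZero (n := n) (A ∩ s)) : MeasureZero (n := n) A := by
  choose! s hs hAs using hA
  obtain ⟨t, htA, ht, hcov⟩ := TopologicalSpace.countable_cover_nhdsWithin
    fun x hx => mem_nhdsWithin_of_mem_nhds (hs x hx)
  refine (biUnion (n := n) ht fun x hx => hAs x (htA hx)).mono fun x hx => ?_
  obtain ⟨y, hy, hxy⟩ := Set.mem_iUnion₂.1 (hcov hx)
  exact Set.mem_iUnion₂.2 ⟨y, hy, hx, hxy⟩

/-- One chart suffices, since transition maps are differentiable and so preserve null sets. -/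
theorem of_chart {n : ℕ} {M : Type*} [TopologicalSpace M]
    [ChartedSpace (EuclideanSpace ℝ (Fin n)) M] [IsManifold (𝓡 n) ∞ M] {A : Set M}
    {φ : OpenPartialHomeomorph M (EuclideanSpace ℝ (Fin n))}
    (hφ : φ ∈ IsManifold.maximalAtlas (𝓡 n) ∞ M) (hA : A ⊆ φ.source)
    (h0 : volume (φ '' A) = 0) : MeasureZero (n := n) A := fun ψ hψ => by
  have himage : ψ '' (A ∩ ψ.source) = (ψ ∘ φ.symm) '' (φ '' (A ∩ ψ.source)) := by
    rw [Set.image_image]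
    exact Set.image_congr fun x hx => by simp [φ.left_inv (hA hx.1)]
  rw [himage]
  refine addHaar_image_eq_zero_of_differentiableOn_of_addHaar_eq_zero volume ?_
    (measure_mono_null (Set.image_mono Set.inter_subset_left) h0)
  rintro _ ⟨x, hx, rfl⟩
  have h1 := contMDiffAt_symm_of_mem_maximalAtlas hφ (φ.map_source (hA hx.1))
  have h2 : ContMDiffAt (𝓡 n) (𝓡 n) ∞ ψ (φ.symm (φ x)) := by
    rw [φ.left_inv (hA hx.1)]
    exact contMDiffAt_of_mem_maximalAtlas hψ hx.2
  exact ((h2.comp _ h1).contDiffAt.differentiableAt (by simp)).differentiableWithinAt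

end MeasureZero

/-! ### The differential in charts. -/

theorem contDiffAt_chart_comp {n : ℕ} {M : Type*} [TopologicalSpace M]
    [ChartedSpace (EuclideanSpace ℝ (Fin n)) M] [IsManifold (𝓡 n) ∞ M] {g : M → M}
    (hg : ContMDiff (𝓡 n) (𝓡 n) 1 g)
    {φ χ : OpenPartialHomeomorph M (EuclideanSpace ℝ (Fin n))}
    (hφ : φ ∈ IsManifold.maximalAtlas (𝓡 n) ∞ M) (hχ : χ ∈ IsManifold.maximalAtlas (𝓡 n) ∞ M)
    {x : M} (hx : x ∈ φ.source) (hgx : g x ∈ χ.source) :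
    ContDiffAt ℝ 1 (χ ∘ g ∘ φ.symm) (φ x) := by
  have h1 := (contMDiffAt_symm_of_mem_maximalAtlas hφ (φ.map_source hx)).of_le
    (show (1 : ℕ∞ω) ≤ ∞ by exact_mod_cast le_top)
  have h2 : ContMDiffAt (𝓡 n) (𝓡 n) 1 (χ ∘ g) (φ.symm (φ x)) := by
    rw [φ.left_inv hx]
    exact ((contMDiffAt_of_mem_maximalAtlas hχ hgx).of_le
      (by exact_mod_cast le_top)).comp x hg.contMDiffAt
  exact (h2.comp _ h1).contDiffAt

theorem isInvertible_fderiv_chart_comp_iff {n : ℕ} {M : Type*} [TopologicalSpace M]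
    [ChartedSpace (EuclideanSpace ℝ (Fin n)) M] [IsManifold (𝓡 n) ∞ M] {g : M → M}
    (hg : ContMDiff (𝓡 n) (𝓡 n) 1 g) {a b x : M}
    (hx : x ∈ (chartAt (EuclideanSpace ℝ (Fin n)) a).source)
    (hgx : g x ∈ (chartAt (EuclideanSpace ℝ (Fin n)) b).source) :
    (fderiv ℝ (chartAt (EuclideanSpace ℝ (Fin n)) b ∘ g ∘
      (chartAt (EuclideanSpace ℝ (Fin n)) a).symm)
      (chartAt (EuclideanSpace ℝ (Fin n)) a x)).IsInvertible ↔
    (mfderiv (𝓡 n) (𝓡 n) g x).IsInvertible := by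
  set φ := chartAt (EuclideanSpace ℝ (Fin n)) a
  set χ := chartAt (EuclideanSpace ℝ (Fin n)) b
  have hM1 : IsManifold (𝓡 n) 1 M := IsManifold.of_le (n := ∞) (by exact_mod_cast le_top)
  have hφ : φ.MDifferentiable (𝓡 n) (𝓡 n) := mdifferentiable_chart a
  have hχ : χ.MDifferentiable (𝓡 n) (𝓡 n) := mdifferentiable_chart b
  let eφ : TangentSpace (𝓡 n) x ≃L[ℝ] TangentSpace (𝓡 n) (φ x) := hφ.mfderiv hx
  let eχ : TangentSpace (𝓡 n) (g x) ≃L[ℝ] TangentSpace (𝓡 n) (χ (g x)) := hχ.mfderiv hgx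
  have hga : HasMFDerivAt (𝓡 n) (𝓡 n) g x (mfderiv (𝓡 n) (𝓡 n) g x) :=
    (hg.mdifferentiableAt (by simp)).hasMFDerivAt
  have h1 : HasMFDerivAt (𝓡 n) (𝓡 n) (χ ∘ g) x
      ((eχ : TangentSpace (𝓡 n) (g x) →L[ℝ] TangentSpace (𝓡 n) (χ (g x))).comp
        (mfderiv (𝓡 n) (𝓡 n) g x)) :=
    (hχ.mdifferentiableAt hgx).hasMFDerivAt.comp x hga
  have hev : (χ ∘ g ∘ φ.symm) ∘ φ =ᶠ[𝓝 x] χ ∘ g := by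
    filter_upwards [φ.open_source.mem_nhds hx] with y hy
    simp [φ.left_inv hy]
  have hG : HasMFDerivAt (𝓡 n) (𝓡 n) (χ ∘ g ∘ φ.symm) (φ x)
      (fderiv ℝ (χ ∘ g ∘ φ.symm) (φ x)) :=
    ((contDiffAt_chart_comp hg (IsManifold.chart_mem_maximalAtlas a)
      (IsManifold.chart_mem_maximalAtlas b) hx hgx).differentiableAt
        (by simp)).hasFDerivAt.hasMFDerivAt
  have h2 : HasMFDerivAt (𝓡 n) (𝓡 n) ((χ ∘ g ∘ φ.symm) ∘ φ) x
      ((fderiv ℝ (χ ∘ g ∘ φ.symm) (φ x)).comp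
        (eφ : TangentSpace (𝓡 n) x →L[ℝ] TangentSpace (𝓡 n) (φ x))) :=
    hG.comp x (hφ.mdifferentiableAt hx).hasMFDerivAt
  have heq := hasMFDerivAt_unique (h2.congr_of_eventuallyEq hev.symm) h1
  constructor
  · intro h
    have h3 := h.comp (ContinuousLinearMap.isInvertible_equiv (f := eφ))
    rw [heq] at h3
    exact (ContinuousLinearMap.isInvertible_equiv_comp (e := eχ)).1 h3
  · intro h
    have h3 := (ContinuousLinearMap.isInvertible_equiv (f := eχ)).comp h
    rw [← heq] at h3
    exact (ContinuousLinearMap.isInvertible_comp_equiv (e := eφ)).1 h3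

theorem derivAtFixedPoint_eq_fderiv {n : ℕ} {M : Type*} [TopologicalSpace M]
    [ChartedSpace (EuclideanSpace ℝ (Fin n)) M] {g : M → M}
    (hg : ContMDiff (𝓡 n) (𝓡 n) 1 g) {x : M} (h : g x = x) :
    (derivAtFixedPoint (n := n) g x h :
      EuclideanSpace ℝ (Fin n) →L[ℝ] EuclideanSpace ℝ (Fin n)) =
    fderiv ℝ (chartAt (EuclideanSpace ℝ (Fin n)) x ∘ g ∘
      (chartAt (EuclideanSpace ℝ (Fin n)) x).symm) (chartAt (EuclideanSpace ℝ (Fin n)) x x) := by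
  -- With the target `y` free, the transport can be eliminated by `rfl`; the equation `g x = x`
  -- itself does not allow this.
  have htrans : ∀ (y : M) (hy : g x = y), (Eq.rec (motive := fun y _ =>
      TangentSpace (𝓡 n) x →L[ℝ] TangentSpace (𝓡 n) y) (mfderiv (𝓡 n) (𝓡 n) g x) hy :
      EuclideanSpace ℝ (Fin n) →L[ℝ] EuclideanSpace ℝ (Fin n)) =
      fderiv ℝ (chartAt (EuclideanSpace ℝ (Fin n)) y ∘ g ∘
        (chartAt (EuclideanSpace ℝ (Fin n)) x).symm)
        (chartAt (EuclideanSpace ℝ (Fin n)) x x) := by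
    rintro _ rfl
    have hm : (mfderiv (𝓡 n) (𝓡 n) g x :
        EuclideanSpace ℝ (Fin n) →L[ℝ] EuclideanSpace ℝ (Fin n)) =
        fderivWithin ℝ (writtenInExtChartAt (𝓡 n) (𝓡 n) x g) (Set.range (𝓡 n))
          (extChartAt (𝓡 n) x x) := if_pos (hg.mdifferentiableAt (by simp))
    refine hm.trans ?_
    simp only [modelWithCornersSelf_coe, Set.range_id, fderivWithin_univ]
    rfl
  exact htrans x h

/-! ### Equivalence of the two conditions. -/

theorem HasLuzinNInv.derivInvertibleAE {n : ℕ} {M : Type*} [TopologicalSpace M]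
    [SecondCountableTopology M] [ChartedSpace (EuclideanSpace ℝ (Fin n)) M]
    [IsManifold (𝓡 n) ∞ M] {g : M → M} (hg : ContMDiff (𝓡 n) (𝓡 n) 1 g)
    (h : HasLuzinNInv (n := n) g) : DerivInvertibleAE (n := n) g := by
  refine MeasureZero.of_locally fun a _ => ?_
  set φ := chartAt (EuclideanSpace ℝ (Fin n)) a with hφ
  set χ := chartAt (EuclideanSpace ℝ (Fin n)) (g a) with hχ
  refine ⟨φ.source ∩ g ⁻¹' χ.source, inter_mem (chart_source_mem_nhds _ a)
    (hg.continuous.continuousAt.preimage_mem_nhds (chart_source_mem_nhds _ (g a))), ?_⟩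
  set C := {x : M | ¬ (mfderiv (𝓡 n) (𝓡 n) g x).IsInvertible} ∩ (φ.source ∩ g ⁻¹' χ.source)
  have hφm : φ ∈ IsManifold.maximalAtlas (𝓡 n) ∞ M := IsManifold.chart_mem_maximalAtlas a
  have hχm : χ ∈ IsManifold.maximalAtlas (𝓡 n) ∞ M := IsManifold.chart_mem_maximalAtlas (g a)
  refine (h (g '' C) (MeasureZero.of_chart hχm ?_ ?_)).mono (Set.subset_preimage_image g C)
  · rintro _ ⟨x, hx, rfl⟩
    exact hx.2.2
  · have himage : χ '' (g '' C) = (χ ∘ g ∘ φ.symm) '' (φ '' C) := by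
      rw [Set.image_image, Set.image_image]
      exact Set.image_congr fun x hx => by simp [φ.left_inv hx.2.1]
    rw [himage]
    refine addHaar_image_eq_zero_of_det_fderivWithin_eq_zero volume
      (f' := fderiv ℝ (χ ∘ g ∘ φ.symm)) ?_ ?_
    · rintro _ ⟨x, hx, rfl⟩
      exact ((contDiffAt_chart_comp hg hφm hχm hx.2.1 hx.2.2).differentiableAt
        (by simp)).hasFDerivAt.hasFDerivWithinAt
    · rintro _ ⟨x, hx, rfl⟩
      by_contra hdet
      refine hx.1 ((isInvertible_fderiv_chart_comp_iff hg hx.2.1 hx.2.2).1 ?_)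
      exact ⟨ContinuousLinearMap.toContinuousLinearEquivOfDetNeZero _ hdet, by ext1 v; rfl⟩

theorem DerivInvertibleAE.hasLuzinNInv {n : ℕ} {M : Type*} [TopologicalSpace M]
    [SecondCountableTopology M] [ChartedSpace (EuclideanSpace ℝ (Fin n)) M]
    [IsManifold (𝓡 n) ∞ M] {g : M → M} (hg : ContMDiff (𝓡 n) (𝓡 n) 1 g)
    (h : DerivInvertibleAE (n := n) g) : HasLuzinNInv (n := n) g := by
  intro E hE
  refine (h.union (B := g ⁻¹' E ∩ {x | (mfderiv (𝓡 n) (𝓡 n) g x).IsInvertible}) ?_).mono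
    fun x hx => (em (mfderiv (𝓡 n) (𝓡 n) g x).IsInvertible).symm.imp id fun hi => ⟨hx, hi⟩
  refine MeasureZero.of_locally fun a ha => ?_
  set φ := chartAt (EuclideanSpace ℝ (Fin n)) a with hφ
  set χ := chartAt (EuclideanSpace ℝ (Fin n)) (g a) with hχ
  have haφ : a ∈ φ.source := mem_chart_source _ a
  have haχ : g a ∈ χ.source := mem_chart_source _ (g a)
  have hφm : φ ∈ IsManifold.maximalAtlas (𝓡 n) ∞ M := IsManifold.chart_mem_maximalAtlas a
  have hχm : χ ∈ IsManifold.maximalAtlas (𝓡 n) ∞ M := IsManifold.chart_mem_maximalAtlas (g a)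
  set G := χ ∘ g ∘ φ.symm with hG
  have hGa : ContDiffAt ℝ 1 G (φ a) := contDiffAt_chart_comp hg hφm hχm haφ haχ
  obtain ⟨e, he⟩ := (isInvertible_fderiv_chart_comp_iff hg haφ haχ).2 ha.2
  have hGe : HasFDerivAt G (e : EuclideanSpace ℝ (Fin n) →L[ℝ] EuclideanSpace ℝ (Fin n)) (φ a) := by
    rw [he]
    exact (hGa.differentiableAt (by simp)).hasFDerivAt
  let H := hGa.localInverse hGe (by simp)
  have hH : ∀ᶠ z in 𝓝 (G (φ a)), DifferentiableAt ℝ H z :=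
    ((hGa.to_localInverse hGe (by simp)).eventually (by simp)).mono
      fun z hz => hz.differentiableAt (by simp)
  have hleft : ∀ᶠ y in 𝓝 (φ a), H (G y) = y :=
    (hGa.hasStrictFDerivAt' hGe (by simp)).eventually_left_inverse
  have hev : ∀ᶠ x in 𝓝 a, x ∈ φ.source ∧ g x ∈ χ.source ∧ H (G (φ x)) = φ x ∧
      DifferentiableAt ℝ H (G (φ x)) := by
    have hφc : Tendsto φ (𝓝 a) (𝓝 (φ a)) := φ.continuousAt haφ
    filter_upwards [φ.open_source.mem_nhds haφ,
      hg.continuous.continuousAt.preimage_mem_nhds (χ.open_source.mem_nhds haχ),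
      hφc.eventually hleft, hφc.eventually (hGa.continuousAt.eventually hH)] with x h1 h2 h3 h4
    exact ⟨h1, h2, h3, h4⟩
  refine ⟨_, hev, ?_⟩
  refine MeasureZero.of_chart hφm (fun x hx => hx.2.1) ?_
  -- The local inverse `H` is known to be differentiable only near `G (φ a)`, hence the restriction.
  set B := {z | z ∈ χ '' (E ∩ χ.source) ∧ DifferentiableAt ℝ H z}
  refine measure_mono_null (t := H '' B) ?_ ?_
  · rintro _ ⟨x, ⟨hx, h1, h2, h3, h4⟩, rfl⟩
    refine ⟨G (φ x), ⟨⟨g x, ⟨hx.1, h2⟩, ?_⟩, h4⟩, h3⟩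
    simp [hG, φ.left_inv h1]
  · exact addHaar_image_eq_zero_of_differentiableOn_of_addHaar_eq_zero volume
      (fun z hz => hz.2.differentiableWithinAt)
      (measure_mono_null (fun z hz => hz.1) (hE χ hχm))

/-! ### Avoidance of unstable fixed points. -/

theorem IsUnstableFixedPoint.exists_nhds_measureZero {n : ℕ} {M : Type*} [TopologicalSpace M]
    [ChartedSpace (EuclideanSpace ℝ (Fin n)) M] [IsManifold (𝓡 n) ∞ M] {g : M → M}
    (hg : ContMDiff (𝓡 n) (𝓡 n) 1 g) {a : M} (ha : IsUnstableFixedPoint (n := n) g a) :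
    ∃ s ∈ 𝓝 a, MeasureZero (n := n) {x | ∀ t : ℕ, g^[t] x ∈ s} := by
  obtain ⟨hga, l, hl, hA⟩ := ha
  set φ := chartAt (EuclideanSpace ℝ (Fin n)) a with hφ
  have haφ : a ∈ φ.source := mem_chart_source _ a
  have hφm : φ ∈ IsManifold.maximalAtlas (𝓡 n) ∞ M := IsManifold.chart_mem_maximalAtlas a
  have hstrict := (contDiffAt_chart_comp hg hφm hφm haφ (hga.symm ▸ haφ)).hasStrictFDerivAt
    (by simp)
  rw [← derivAtFixedPoint_eq_fderiv hg hga] at hstrict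
  obtain ⟨s, hs, hnull⟩ := exists_nhds_invariant_null volume hstrict hl hA
  refine ⟨φ.source ∩ φ ⁻¹' s, inter_mem (φ.open_source.mem_nhds haφ)
    ((φ.continuousAt haφ).preimage_mem_nhds hs), MeasureZero.of_chart hφm (fun x hx => (hx 0).1)
    (hnull _ ?_ ?_)⟩
  · rintro _ ⟨x, hx, rfl⟩
    exact (hx 0).2
  · rintro _ ⟨x, hx, rfl⟩
    refine ⟨g x, fun t => hx (t + 1), ?_⟩
    have := φ.left_inv (hx 0).1
    simp only [Function.iterate_zero, id] at this
    simp [this]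

theorem HasLuzinNInv.avoids_unstableFixedPoints {n : ℕ} {M : Type*} [TopologicalSpace M]
    [SecondCountableTopology M] [ChartedSpace (EuclideanSpace ℝ (Fin n)) M]
    [IsManifold (𝓡 n) ∞ M] {g : M → M} (hg : ContMDiff (𝓡 n) (𝓡 n) 1 g)
    (h : HasLuzinNInv (n := n) g) :
    Avoids (n := n) g {x : M | IsUnstableFixedPoint (n := n) g x} := by
  have hloc : ∀ a ∈ {x : M | IsUnstableFixedPoint (n := n) g x}, ∃ s ∈ 𝓝 a,
      MeasureZero (n := n) {x | ∀ t : ℕ, g^[t] x ∈ s} := fun a ha =>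
    IsUnstableFixedPoint.exists_nhds_measureZero hg ha
  choose! s hs hnull using hloc
  -- There may be uncountably many unstable fixed points. Interiors are used because the limit `y`
  -- is covered by the neighborhood of another point `a`, which must also be a neighborhood of `y`.
  obtain ⟨c, hcS, hc, hcov⟩ := TopologicalSpace.countable_cover_nhdsWithin
    fun x hx => mem_nhdsWithin_of_mem_nhds (interior_mem_nhds.2 (hs x hx))
  have hiter : ∀ (T : ℕ) (E : Set M), MeasureZero (n := n) E →
      MeasureZero (n := n) (g^[T] ⁻¹' E) := fun T => by
    induction T with
    | zero => exact fun E hE => hE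
    | succ T ih =>
      intro E hE
      exact h _ (ih E hE)
  refine (MeasureZero.biUnion (n := n) hc fun a ha => MeasureZero.iUnion (n := n) fun T : ℕ =>
    hiter T _ (hnull a (hcS ha))).mono fun x hx => ?_
  obtain ⟨y, hy, hxy⟩ := Set.mem_iUnion₂.1 hx
  obtain ⟨a, ha, hya⟩ := Set.mem_iUnion₂.1 (hcov hy)
  obtain ⟨T, hT⟩ := eventually_atTop.1
    (Tendsto.eventually_mem hxy (isOpen_interior.mem_nhds hya))
  refine Set.mem_iUnion₂.2 ⟨a, ha, Set.mem_iUnion.2 ⟨T, fun t => ?_⟩⟩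
  rw [← Function.iterate_add_apply]
  exact interior_subset (hT (t + T) (Nat.le_add_left T t))

theorem mainTheorem2 {n : ℕ} {M : Type*} [TopologicalSpace M] [T2Space M]
    [SecondCountableTopology M] [ChartedSpace (EuclideanSpace ℝ (Fin n)) M]
    [IsManifold (𝓡 n) ∞ M] (g : M → M) (hg : ContMDiff (𝓡 n) (𝓡 n) 1 g) :
    (HasLuzinNInv (n := n) g ↔ DerivInvertibleAE (n := n) g) ∧
    (HasLuzinNInv (n := n) g → Avoids (n := n) g {x : M | IsUnstableFixedPoint (n := n) g x}) ∧
    (DerivInvertibleAE (n := n) g →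
      Avoids (n := n) g {x : M | IsUnstableFixedPoint (n := n) g x}) :=
  ⟨⟨HasLuzinNInv.derivInvertibleAE hg, DerivInvertibleAE.hasLuzinNInv hg⟩,
    HasLuzinNInv.avoids_unstableFixedPoints hg,
    fun h => HasLuzinNInv.avoids_unstableFixedPoints hg (DerivInvertibleAE.hasLuzinNInv hg h)⟩
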